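/- Let $k,m$ be natural numbers, let $\mathcal M_k$ be the algebra of complex $k\times k$ matrices, and identify $\mathcal M_k\otimes\mathcal M_m\simeq\mathcal M_{km}$ via the Kronecker product. A (non-normalized) *state* of $\mathcal M_k\otimes\mathcal M_m$ is a positive semidefinite Hermitian matrix $\gamma=\sum_{i=1}^n A_i\otimes B_i$. Associate to it the linear maps $$G_\gamma:\mathcal M_k\to\mathcal M_m,\quad G_\gamma(X)=\sum_{i=1}^n \operatorname{tr}(A_iX)B_i,\qquad F_\gamma:\mathcal M_m\to\mathcal M_k,\quad F_\gamma(Y)=\sum_{i=1}^n \operatorname{tr}(B_iY)A_i .$$ A linear map $T:\mathcal M_k\to\mathcal M_k$ that is positive (it maps positive semidefinite matrices to positive semidefinite matrices) and self-adjoint for the trace inner product $\langle X,Y\rangle=\operatorname{tr}(XY^*)$ is called *completely reducible* if there are orthogonal projections $W_1,\dots,W_l\in\mathcal M_k$ with $W_iW_j=0$ for $i\ne j$ such that: - $T(W_i\mathcal M_kW_i)\subset W_i\mathcal M_kW_i$ for every $i$; - $T|_{W_i\mathcal M_kW_i}$ is irreducible for every $i$, i.e. if $W$ is an orthogonal projection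 with $W\mathcal M_kW\subset W_i\mathcal M_kW_i$ and $T(W\mathcal M_kW)\subset W\mathcal M_kW$, then $W=0$ or $W=W_i$; - $T|_R\equiv 0$, where $R$ is the orthogonal complement of $\bigoplus_{i}W_i\mathcal M_kW_i$ in $\mathcal M_k$ with respect to the trace inner product. Let $CR_{k,m}$ be the set of all states $\gamma$ of $\mathcal M_k\otimes\mathcal M_m$ such that $F_\gamma\circ G_\gamma:\mathcal M_k\to\mathcal M_k$ is positive, self-adjoint and completely reducible. **Theorem.** The set $CR_{k,m}$ is a convex cone (it is convex, contains $0$, and is closed under multiplication by non-negative real scalars). It is contained and dense in the cone of all states of $\mathcal M_k\otimes\mathcal M_m$. Moreover, if $k\ge 2$ and $m\ge 2$, then $CR_{k,m}$ is not closed. -/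

import Mathlib

open scoped Kronecker ComplexOrder

namespace CompRed

/-- The sub-algebra `V M_k V = {V X V : X ∈ M_k}` of `M_k`, as a complex subspace. -/
def corner {k : ℕ} (V : Matrix (Fin k) (Fin k) ℂ) :
    Submodule ℂ (Matrix (Fin k) (Fin k) ℂ) where
  carrier := {Y | ∃ X, V * X * V = Y}
  add_mem' := by
    rintro _ _ ⟨X, rfl⟩ ⟨Y, rfl⟩
    exact ⟨X + Y, by rw [mul_add, add_mul]⟩
  zero_mem' := ⟨0, by simp⟩
  smul_mem' := by
    rintro c _ ⟨X, rfl⟩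
    exact ⟨c • X, by simp⟩

/-- `T` leaves the subspace `S` invariant. -/
def LeavesInvariant {k : ℕ}
    (T : Matrix (Fin k) (Fin k) ℂ →ₗ[ℂ] Matrix (Fin k) (Fin k) ℂ)
    (S : Submodule ℂ (Matrix (Fin k) (Fin k) ℂ)) : Prop :=
  ∀ X ∈ S, T X ∈ S

/-- The restriction of `T` to `V M_k V` is irreducible: the only sub-algebras `W M_k W` of
`V M_k V` (`W` an orthogonal projection) left invariant by `T` are those with `W = 0` or
`W = V`. -/
def IsIrreducibleOn {k : ℕ}
    (T : Matrix (Fin k) (Fin k) ℂ →ₗ[ℂ] Matrix (Fin k) (Fin k) ℂ)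
    (V : Matrix (Fin k) (Fin k) ℂ) : Prop :=
  ∀ W : Matrix (Fin k) (Fin k) ℂ, IsStarProjection W → corner W ≤ corner V →
    LeavesInvariant T (corner W) → W = 0 ∨ W = V

/-- Positive map on `V M_k V`: positive semidefinite matrices go to positive semidefinite ones. -/
def IsPositiveOn {k : ℕ}
    (T : Matrix (Fin k) (Fin k) ℂ →ₗ[ℂ] Matrix (Fin k) (Fin k) ℂ)
    (V : Matrix (Fin k) (Fin k) ℂ) : Prop :=
  ∀ X ∈ corner V, X.PosSemidef → (T X).PosSemidef

/-- Self-adjointness on `V M_k V` for the trace inner product `tr (X Y^*)`. -/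
def IsTraceSelfAdjointOn {k : ℕ}
    (T : Matrix (Fin k) (Fin k) ℂ →ₗ[ℂ] Matrix (Fin k) (Fin k) ℂ)
    (V : Matrix (Fin k) (Fin k) ℂ) : Prop :=
  ∀ X ∈ corner V, ∀ Y ∈ corner V,
    (T X * Y.conjTranspose).trace = (X * (T Y).conjTranspose).trace

/-- The self-adjoint positive map `T : V M_k V → V M_k V` is completely reducible: there are
mutually orthogonal projections `W 1, …, W l` with `W i M_k W i ⊆ V M_k V`, each `W i M_k W i`
invariant under `T` with `T` irreducible on it, such that `T` vanishes on `R`, the orthogonal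
complement of `⨁ i, W i M_k W i` inside `V M_k V` for the trace inner product.
(As `W i * W j = 0` for `i ≠ j`, the subspaces `W i M_k W i` are pairwise orthogonal, so that
`V M_k V = (⨁ i, W i M_k W i) ⊕ R` holds automatically.) -/
def IsCompletelyReducibleOn {k : ℕ}
    (T : Matrix (Fin k) (Fin k) ℂ →ₗ[ℂ] Matrix (Fin k) (Fin k) ℂ)
    (V : Matrix (Fin k) (Fin k) ℂ) : Prop :=
  LeavesInvariant T (corner V) ∧ IsPositiveOn T V ∧ IsTraceSelfAdjointOn T V ∧
  ∃ (l : ℕ) (W : Fin l → Matrix (Fin k) (Fin k) ℂ),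
    (∀ i, IsStarProjection (W i)) ∧
    (∀ i, corner (W i) ≤ corner V) ∧
    (∀ i j, i ≠ j → W i * W j = 0) ∧
    (∀ i, LeavesInvariant T (corner (W i))) ∧
    (∀ i, IsIrreducibleOn T (W i)) ∧
    (∀ X ∈ corner V,
      (∀ i, ∀ Y ∈ corner (W i), (X * Y.conjTranspose).trace = 0) → T X = 0)

/-- `G_γ : M_k → M_m`, `G_γ(X) = ∑ i, tr(A i X) B i` for `γ = ∑ i, A i ⊗ B i`, written in
entries (see `mapG_sum_kronecker`). -/
def mapG {k m : ℕ} (γ : Matrix (Fin k × Fin m) (Fin k × Fin m) ℂ) :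
    Matrix (Fin k) (Fin k) ℂ →ₗ[ℂ] Matrix (Fin m) (Fin m) ℂ where
  toFun X := Matrix.of fun b d => ∑ a, ∑ c, γ (a, b) (c, d) * X c a
  map_add' X Y := by
    ext b d
    simp [mul_add, Finset.sum_add_distrib]
  map_smul' r X := by
    ext b d
    simp [Finset.mul_sum, mul_left_comm]

/-- `F_γ : M_m → M_k`, `F_γ(Y) = ∑ i, tr(B i Y) A i` for `γ = ∑ i, A i ⊗ B i`, written in
entries (see `mapF_sum_kronecker`). -/
def mapF {k m : ℕ} (γ : Matrix (Fin k × Fin m) (Fin k × Fin m) ℂ) :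
    Matrix (Fin m) (Fin m) ℂ →ₗ[ℂ] Matrix (Fin k) (Fin k) ℂ where
  toFun Y := Matrix.of fun a c => ∑ b, ∑ d, γ (a, b) (c, d) * Y d b
  map_add' X Y := by
    ext b d
    simp [mul_add, Finset.sum_add_distrib]
  map_smul' r X := by
    ext b d
    simp [Finset.mul_sum, mul_left_comm]

theorem mapG_sum_kronecker {k m n : ℕ} (A : Fin n → Matrix (Fin k) (Fin k) ℂ)
    (B : Fin n → Matrix (Fin m) (Fin m) ℂ) (X : Matrix (Fin k) (Fin k) ℂ) :
    mapG (∑ i, A i ⊗ₖ B i) X = ∑ i, (A i * X).trace • B i := by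
  ext b d
  simp only [mapG, LinearMap.coe_mk, AddHom.coe_mk, Matrix.of_apply, Matrix.sum_apply,
    Matrix.kroneckerMap_apply, Matrix.smul_apply, smul_eq_mul, Matrix.trace, Matrix.diag_apply,
    Matrix.mul_apply, Finset.sum_mul]
  simp_rw [Finset.sum_comm (s := (Finset.univ : Finset (Fin k))) (t := (Finset.univ : Finset (Fin n)))]
  refine Finset.sum_congr rfl fun i _ => ?_
  refine Finset.sum_congr rfl fun a _ => Finset.sum_congr rfl fun c _ => ?_
  ring

theorem mapF_sum_kronecker {k m n : ℕ} (A : Fin n → Matrix (Fin k) (Fin k) ℂ)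
    (B : Fin n → Matrix (Fin m) (Fin m) ℂ) (Y : Matrix (Fin m) (Fin m) ℂ) :
    mapF (∑ i, A i ⊗ₖ B i) Y = ∑ i, (B i * Y).trace • A i := by
  ext b d
  simp only [mapF, LinearMap.coe_mk, AddHom.coe_mk, Matrix.of_apply, Matrix.sum_apply,
    Matrix.kroneckerMap_apply, Matrix.smul_apply, smul_eq_mul, Matrix.trace, Matrix.diag_apply,
    Matrix.mul_apply, Finset.sum_mul]
  simp_rw [Finset.sum_comm (s := (Finset.univ : Finset (Fin m))) (t := (Finset.univ : Finset (Fin n)))]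
  refine Finset.sum_congr rfl fun i _ => ?_
  refine Finset.sum_congr rfl fun a _ => Finset.sum_congr rfl fun c _ => ?_
  ring

/-- The (non-normalized) states of `M_k ⊗ M_m ≃ M_{km}`: the positive semidefinite Hermitian
matrices. -/
def states (k m : ℕ) : Set (Matrix (Fin k × Fin m) (Fin k × Fin m) ℂ) :=
  {γ | γ.PosSemidef}

/-- `CR_{k,m}`: the states `γ` such that `F_γ ∘ G_γ : M_k → M_k` is completely reducible. -/
def CR (k m : ℕ) : Set (Matrix (Fin k × Fin m) (Fin k × Fin m) ℂ) :=
  {γ | γ ∈ states k m ∧ IsCompletelyReducibleOn (mapF γ ∘ₗ mapG γ) 1}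

end CompRed

/-!
Write `T γ = F_γ ∘ G_γ`. For a state `γ` the maps `F_γ`, `G_γ` are positive and adjoint to each
other, so `T γ` is positive, self-adjoint and has the kernel of `G_γ`. The proof replaces complete
reducibility by a condition that behaves well under sums, the *decomposition property*: whenever
the corner of an orthogonal projection `W` is invariant under `T γ`, the map `G_γ` kills every
off-diagonal part `W * X * (1 - W)`. By `mem_CR_iff`, `γ ∈ CR k m` if and only if `γ` is a state
with this property.

* From the property to complete reducibility: for a self-adjoint positive map the complement of an
  invariant corner in an invariant corner is invariant, so `1` splits into orthogonal projections
  with invariant irreducible corners (`exists_irreducible_decomposition`), and the property kills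
  everything orthogonal to these corners.
* From complete reducibility to the property: if `P` is one of the irreducible projections and `W`
  has an invariant corner, the meet of `P` with `W` has an invariant corner, and likewise with
  `1 - W`. Irreducibility leaves only `P ≤ W`, `P ≤ 1 - W` or `T γ P = 0`
  (`irreducible_dichotomy`), and `T γ` vanishes on `P * W * X * (1 - W) * P` in each case.

Convexity: `T (γ + δ) W` is the sum of `T γ W`, `T δ W` and two positive mixed terms, so a corner
invariant for `γ + δ` is invariant for `γ` and for `δ`; then both `G_γ` and `G_δ` kill the
off-diagonal part, and so does `G_(γ + δ) = G_γ + G_δ`. Density: after adding a positive multiple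
of `1` to a state the only invariant corners are those of `0` and `1`
(`add_smul_one_mem_CR`). As `CR k m` is dense in the states, it fails to be closed as soon as some
state lies outside it, and for `2 ≤ k`, `2 ≤ m` the maximally entangled state of a pair of qubits
does (`exists_state_notMem_CR`).
-/

namespace CompRed

open Matrix

/-! ### Positive semidefinite matrices and orthogonal projections -/

section Positivity

variable {n : Type*} [Fintype n]

theorem mul_eq_zero_of_conj_eq_zero {p : Type*} [Fintype p] {A : Matrix n n ℂ}
    (hA : A.PosSemidef) {N : Matrix n p ℂ} (h : Nᴴ * A * N = 0) : A * N = 0 := by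
  classical
  obtain ⟨B, rfl⟩ : ∃ B : Matrix n n ℂ, A = Bᴴ * B := by
    open scoped MatrixOrder Matrix.Norms.L2Operator in
    exact CStarAlgebra.nonneg_iff_eq_star_mul_self.mp hA.nonneg
  have hB : (B * N)ᴴ * (B * N) = 0 := by
    rw [conjTranspose_mul, ← h]
    simp only [Matrix.mul_assoc]
  rw [Matrix.mul_assoc, conjTranspose_mul_self_eq_zero.mp hB, Matrix.mul_zero]

theorem mul_eq_zero_of_add_mul_eq_zero {p : Type*} [Fintype p] {A B : Matrix n n ℂ}
    (hA : A.PosSemidef) (hB : B.PosSemidef) {N : Matrix n p ℂ} (h : (A + B) * N = 0) :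
    A * N = 0 := by
  classical
  have hsum : Nᴴ * A * N + Nᴴ * B * N = 0 := by
    rw [← Matrix.add_mul, ← Matrix.mul_add, Matrix.mul_assoc, h, Matrix.mul_zero]
  have htr := congrArg trace hsum
  rw [trace_add, trace_zero] at htr
  have hA' := hA.conjTranspose_mul_mul_same N
  have hB' := hB.conjTranspose_mul_mul_same N
  refine mul_eq_zero_of_conj_eq_zero hA (hA'.trace_eq_zero_iff.mp ?_)
  exact ((add_eq_zero_iff_of_nonneg hA'.trace_nonneg hB'.trace_nonneg).mp htr).1

theorem mul_eq_zero_of_trace_mul_eq_zero {A W : Matrix n n ℂ} (hA : A.PosSemidef)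
    (hW : IsStarProjection W) (h : (A * W).trace = 0) : A * W = 0 := by
  have hWs : Wᴴ = W := hW.2
  refine mul_eq_zero_of_conj_eq_zero hA
    ((hA.conjTranspose_mul_mul_same W).trace_eq_zero_iff.mp ?_)
  rw [Matrix.mul_assoc, trace_mul_comm, hWs, Matrix.mul_assoc, hW.1.eq, h]

theorem posSemidef_of_isStarProjection {W : Matrix n n ℂ} (hW : IsStarProjection W) :
    W.PosSemidef := by
  have h := posSemidef_conjTranspose_mul_self W
  rwa [show Wᴴ = W from hW.2, hW.1.eq] at h

theorem mul_eq_zero_comm_of_isHermitian {A B : Matrix n n ℂ} (hA : A.IsHermitian)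
    (hB : B.IsHermitian) (h : A * B = 0) : B * A = 0 := by
  rw [← hA.eq, ← hB.eq, ← conjTranspose_mul, h, conjTranspose_zero]

/-- A positive semidefinite matrix is dominated by a multiple of the identity. -/
theorem exists_smul_one_sub_posSemidef [DecidableEq n] {A : Matrix n n ℂ} (hA : A.PosSemidef) :
    ∃ c : ℂ, (c • (1 : Matrix n n ℂ) - A).PosSemidef := by
  open scoped MatrixOrder Matrix.Norms.L2Operator in
  have h := IsSelfAdjoint.le_algebraMap_norm_self (a := A) hA.1
  refine ⟨(‖A‖ : ℝ), ?_⟩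
  have h2 := Matrix.le_iff.mp h
  rw [Algebra.algebraMap_eq_smul_one] at h2
  simpa using h2

/-- The meet of two orthogonal projections `P` and `Q`, obtained as one minus the support
projection of `(1 - P) + (1 - Q)`. -/
theorem exists_meet_projection [DecidableEq n] {P Q : Matrix n n ℂ} (hP : IsStarProjection P)
    (hQ : IsStarProjection Q) :
    ∃ U : Matrix n n ℂ, IsStarProjection U ∧
      ∀ X : Matrix n n ℂ, U * X = X ↔ P * X = X ∧ Q * X = X := by
  set A : Matrix n n ℂ := (1 - P) + (1 - Q) with hAdef
  have hA1 := posSemidef_of_isStarProjection hP.one_sub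
  have hA2 := posSemidef_of_isStarProjection hQ.one_sub
  have hA : A.PosSemidef := hA1.add hA2
  have hsa : IsSelfAdjoint A := hA.1
  have hfin : (spectrum ℝ A).Finite := Matrix.finite_real_spectrum
  have hc : ∀ f : ℝ → ℝ, ContinuousOn f (spectrum ℝ A) := fun f => hfin.continuousOn f
  -- `S` is the support projection of `A`: `A * S = A`, and `S` is a left multiple of `A`, so `A` and
  -- `S` annihilate the same matrices. The spectrum is finite, so the discontinuous function is
  -- admissible for the functional calculus.
  set S := cfc (fun x : ℝ => if x = 0 then 0 else 1) A with hS
  have hSS : IsStarProjection S := by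
    refine ⟨?_, cfc_predicate _ _⟩
    change S * S = S
    rw [hS, ← cfc_mul _ _ _ (hc _) (hc _)]
    congr 1; ext x; split_ifs <;> simp
  have hSA : S * A = A := by
    have hid := cfc_id' ℝ A hsa
    calc S * A = S * cfc (fun x : ℝ => x) A := by rw [hid]
      _ = cfc (fun x : ℝ => (if x = 0 then 0 else 1) * x) A := by
        rw [hS, ← cfc_mul _ _ _ (hc _) (hc _)]
      _ = cfc (fun x : ℝ => x) A := by
        congr 1; ext x; split_ifs with h <;> simp [h]
      _ = A := hid
  have hST : S = cfc (fun x : ℝ => x⁻¹) A * A := by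
    nth_rewrite 2 [← cfc_id' ℝ A hsa]
    rw [← cfc_mul _ _ _ (hc _) (hc _), hS]
    congr 1; ext x; split_ifs with h <;> simp [h]
  have hAS : A * S = A := by
    have := congrArg conjTranspose hSA
    rwa [conjTranspose_mul, hA.1.eq, show Sᴴ = S from hSS.2] at this
  refine ⟨1 - S, hSS.one_sub, fun X => ?_⟩
  have key : ∀ R : Matrix n n ℂ, (1 - R) * X = X ↔ R * X = 0 := fun R => by
    rw [Matrix.sub_mul, Matrix.one_mul, sub_eq_self]
  have key' : ∀ R : Matrix n n ℂ, R * X = X ↔ (1 - R) * X = 0 := fun R => by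
    rw [← key, sub_sub_cancel]
  rw [key, key', key']
  constructor
  · intro h
    have h0 : A * X = 0 := by rw [← hAS, Matrix.mul_assoc, h, Matrix.mul_zero]
    exact ⟨mul_eq_zero_of_add_mul_eq_zero hA1 hA2 h0,
      mul_eq_zero_of_add_mul_eq_zero hA2 hA1 (by rw [add_comm]; exact h0)⟩
  · rintro ⟨h1, h2⟩
    rw [hST, Matrix.mul_assoc, hAdef, Matrix.add_mul, h1, h2, add_zero, Matrix.mul_zero]

end Positivity

/-! ### Corners, positive maps and irreducibility -/

section Corner

variable {k : ℕ} {V W X : Matrix (Fin k) (Fin k) ℂ}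

theorem mem_corner_iff (hV : IsStarProjection V) : X ∈ corner V ↔ V * X = X ∧ X * V = X := by
  constructor
  · rintro ⟨Y, rfl⟩
    constructor
    · rw [← mul_assoc, ← mul_assoc, hV.1.eq]
    · rw [mul_assoc, hV.1.eq]
  · rintro ⟨h1, h2⟩
    exact ⟨X, by rw [h1, h2]⟩

theorem mem_corner_self (hV : IsStarProjection V) : V ∈ corner V :=
  (mem_corner_iff hV).2 ⟨hV.1.eq, hV.1.eq⟩

theorem mem_corner_one : X ∈ corner (1 : Matrix (Fin k) (Fin k) ℂ) := ⟨X, by simp⟩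

theorem corner_le_corner (hV : IsStarProjection V) (hW : W ∈ corner V) :
    corner W ≤ corner V := by
  obtain ⟨h1, h2⟩ := (mem_corner_iff hV).1 hW
  rintro _ ⟨X, rfl⟩
  refine (mem_corner_iff hV).2 ⟨?_, ?_⟩
  · rw [← mul_assoc, ← mul_assoc, h1]
  · rw [mul_assoc, h2]

/-- Every element of a corner is a combination of positive semidefinite elements, by the
polarization identity applied to `X = W * X`. -/
theorem corner_induction (hW : IsStarProjection W) {p : Matrix (Fin k) (Fin k) ℂ → Prop}
    (hpos : ∀ C ∈ corner W, C.PosSemidef → p C) (hadd : ∀ C D, p C → p D → p (C + D))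
    (hsmul : ∀ (c : ℂ) (C), p C → p (c • C)) (hX : X ∈ corner W) : p X := by
  obtain ⟨h1, h2⟩ := (mem_corner_iff hW).1 hX
  have hWs : Wᴴ = W := hW.2
  have h1' : Xᴴ * W = Xᴴ := by rw [← hWs, ← conjTranspose_mul, h1]
  have h2' : W * Xᴴ = Xᴴ := by rw [← hWs, ← conjTranspose_mul, h2]
  have hC : ∀ z : ℂ, p ((W + z • Xᴴ)ᴴ * (W + z • Xᴴ)) := fun z => by
    refine hpos _ ((mem_corner_iff hW).2 ⟨?_, ?_⟩) (posSemidef_conjTranspose_mul_self _)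
    · rw [← mul_assoc]
      congr 1
      rw [conjTranspose_add, hWs, conjTranspose_smul, conjTranspose_conjTranspose, mul_add,
        hW.1.eq, mul_smul_comm, h1]
    · rw [mul_assoc, add_mul, hW.1.eq, smul_mul_assoc, h1']
  have hXeq : X = (1 / 4 : ℂ) • ((W + (1 : ℂ) • Xᴴ)ᴴ * (W + (1 : ℂ) • Xᴴ)) +
      ((-1 / 4 : ℂ) • ((W + (-1 : ℂ) • Xᴴ)ᴴ * (W + (-1 : ℂ) • Xᴴ)) +
      ((Complex.I / 4 : ℂ) • ((W + Complex.I • Xᴴ)ᴴ * (W + Complex.I • Xᴴ)) +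
      (-Complex.I / 4 : ℂ) • ((W + (-Complex.I) • Xᴴ)ᴴ * (W + (-Complex.I) • Xᴴ)))) := by
    simp only [conjTranspose_add, hWs, conjTranspose_smul, conjTranspose_conjTranspose, mul_add,
      add_mul, hW.1.eq, mul_smul_comm, smul_mul_assoc, h2, h2']
    ext i j
    simp only [Matrix.add_apply, Matrix.smul_apply, smul_eq_mul, star_one, star_neg,
      Complex.star_def, Complex.conj_I]
    ring_nf
    rw [Complex.I_sq]
    ring
  rw [hXeq]
  exact hadd _ _ (hsmul _ _ (hC _)) (hadd _ _ (hsmul _ _ (hC _))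
    (hadd _ _ (hsmul _ _ (hC _)) (hsmul _ _ (hC _))))

/-- A positive map whose value at the projection `W` is annihilated by `N` takes values
annihilated by `N` on the whole corner of `W`, since every positive semidefinite element of the
corner is dominated by a multiple of `W`. -/
theorem map_corner_mul_eq_zero {n : ℕ} {p : Type*} [Fintype p]
    {T : Matrix (Fin k) (Fin k) ℂ →ₗ[ℂ] Matrix (Fin n) (Fin n) ℂ}
    (hT : ∀ X, X.PosSemidef → (T X).PosSemidef) (hW : IsStarProjection W)
    {N : Matrix (Fin n) p ℂ} (h : T W * N = 0) (hX : X ∈ corner W) : T X * N = 0 := by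
  refine corner_induction hW (p := fun X => T X * N = 0) ?_ ?_ ?_ hX
  · intro C hCW hC
    obtain ⟨h1, h2⟩ := (mem_corner_iff hW).1 hCW
    obtain ⟨c, hc⟩ := exists_smul_one_sub_posSemidef hC
    have hWs : Wᴴ = W := hW.2
    have hd : (c • W - C).PosSemidef := by
      have := hc.conjTranspose_mul_mul_same W
      rwa [hWs, mul_sub, sub_mul, h1, h2, mul_smul_comm, smul_mul_assoc, mul_one, hW.1.eq] at this
    refine mul_eq_zero_of_add_mul_eq_zero (hT _ hC) (hT _ hd) ?_
    rw [← map_add, add_sub_cancel, map_smul, Matrix.smul_mul, h, smul_zero]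
  · intro C D hC hD
    simp only [map_add, Matrix.add_mul, hC, hD, add_zero]
  · intro c C hC
    simp only [map_smul, Matrix.smul_mul, hC, smul_zero]

theorem map_corner_eq_zero {n : ℕ}
    {T : Matrix (Fin k) (Fin k) ℂ →ₗ[ℂ] Matrix (Fin n) (Fin n) ℂ}
    (hT : ∀ X, X.PosSemidef → (T X).PosSemidef) (hW : IsStarProjection W)
    (h : T W = 0) (hX : X ∈ corner W) : T X = 0 := by
  simpa using map_corner_mul_eq_zero hT hW (N := (1 : Matrix (Fin n) (Fin n) ℂ))
    (by rw [h, Matrix.zero_mul]) hX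

variable {T : Matrix (Fin k) (Fin k) ℂ →ₗ[ℂ] Matrix (Fin k) (Fin k) ℂ}

/-- For a positive map, invariance of a corner can be tested on its projection. -/
theorem leavesInvariant_iff (hT : ∀ X, X.PosSemidef → (T X).PosSemidef)
    (hW : IsStarProjection W) : LeavesInvariant T (corner W) ↔ T W * (1 - W) = 0 := by
  constructor
  · intro h
    rw [mul_sub, mul_one, sub_eq_zero]
    exact ((mem_corner_iff hW).1 (h W (mem_corner_self hW))).2.symm
  · intro h X hX
    refine corner_induction hW (p := fun X => T X ∈ corner W) ?_ ?_ ?_ hX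
    · intro C hCW hC
      have h1 : T C * (1 - W) = 0 := map_corner_mul_eq_zero hT hW h hCW
      have h2 := mul_eq_zero_comm_of_isHermitian (hT C hC).1
        (posSemidef_of_isStarProjection hW.one_sub).1 h1
      rw [mul_sub, mul_one, sub_eq_zero] at h1
      rw [sub_mul, one_mul, sub_eq_zero] at h2
      exact (mem_corner_iff hW).2 ⟨h2.symm, h1.symm⟩
    · intro C D hC hD
      rw [map_add]
      exact add_mem hC hD
    · intro c C hC
      rw [map_smul]
      exact Submodule.smul_mem _ c hC

/-- A self-adjoint positive map leaving the corner of `W` invariant leaves the corner of `1 - W`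
invariant: `tr (T (1 - W) * W) = tr ((1 - W) * T W) = 0`. -/
theorem map_one_sub_mul_eq_zero (hT : ∀ X, X.PosSemidef → (T X).PosSemidef)
    (hsa : ∀ X Y, (T X * Y).trace = (X * T Y).trace) (hW : IsStarProjection W)
    (h : T W * (1 - W) = 0) : T (1 - W) * W = 0 := by
  refine mul_eq_zero_of_trace_mul_eq_zero (hT _ (posSemidef_of_isStarProjection hW.one_sub)) hW ?_
  rw [hsa, trace_mul_comm, h, trace_zero]

/-- The complement of an invariant corner inside an invariant corner is invariant. -/
theorem leavesInvariant_corner_sub (hT : ∀ X, X.PosSemidef → (T X).PosSemidef)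
    (hsa : ∀ X Y, (T X * Y).trace = (X * T Y).trace) (hV : IsStarProjection V)
    (hW : IsStarProjection W) (hVW : IsStarProjection (V - W)) (hmem : V - W ∈ corner V)
    (hinvV : LeavesInvariant T (corner V)) (hinvW : LeavesInvariant T (corner W)) :
    LeavesInvariant T (corner (V - W)) := by
  have h0 := map_one_sub_mul_eq_zero hT hsa hW ((leavesInvariant_iff hT hW).1 hinvW)
  rw [leavesInvariant_iff hT hV] at hinvV
  rw [leavesInvariant_iff hT hVW]
  have h1 : T (V - W) * (1 - V) = 0 := map_corner_mul_eq_zero hT hV hinvV hmem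
  have h2 : T (V - W) * W = 0 := by
    refine mul_eq_zero_of_add_mul_eq_zero (hT _ (posSemidef_of_isStarProjection hVW))
      (hT _ (posSemidef_of_isStarProjection hV.one_sub)) ?_
    rw [← map_add, ← h0]
    congr 2
    abel
  rw [show (1 : Matrix (Fin k) (Fin k) ℂ) - (V - W) = (1 - V) + W by abel, mul_add, h1, h2,
    add_zero]

/-- The projection of an invariant corner of a self-adjoint positive map is a sum of mutually
orthogonal projections whose corners are invariant and irreducible. A reducible corner contains
two smaller complementary invariant ones, so induction on the corner applies. -/
theorem exists_irreducible_decomposition (hT : ∀ X, X.PosSemidef → (T X).PosSemidef)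
    (hsa : ∀ X Y, (T X * Y).trace = (X * T Y).trace) (V : Matrix (Fin k) (Fin k) ℂ)
    (hV : IsStarProjection V) (hinv : LeavesInvariant T (corner V)) :
    ∃ (l : ℕ) (W : Fin l → Matrix (Fin k) (Fin k) ℂ),
      (∀ i, IsStarProjection (W i)) ∧ (∀ i j, i ≠ j → W i * W j = 0) ∧
      (∀ i, LeavesInvariant T (corner (W i))) ∧ (∀ i, IsIrreducibleOn T (W i)) ∧
      ∑ i, W i = V := by
  suffices H : ∀ (S : Submodule ℂ (Matrix (Fin k) (Fin k) ℂ)) (V : Matrix (Fin k) (Fin k) ℂ),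
      corner V = S → IsStarProjection V → LeavesInvariant T (corner V) →
      ∃ (ι : Type) (_ : Fintype ι) (W : ι → Matrix (Fin k) (Fin k) ℂ),
      (∀ i, IsStarProjection (W i)) ∧ (∀ i j, i ≠ j → W i * W j = 0) ∧
      (∀ i, LeavesInvariant T (corner (W i))) ∧ (∀ i, IsIrreducibleOn T (W i)) ∧
      ∑ i, W i = V by
    obtain ⟨ι, _, W, h1, h2, h3, h4, h5⟩ := H _ V rfl hV hinv
    let e := (Fintype.equivFin ι).symm
    exact ⟨Fintype.card ι, W ∘ e, fun i => h1 _, fun i j hij => h2 _ _ (e.injective.ne hij),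
      fun i => h3 _, fun i => h4 _, (e.sum_comp W).trans h5⟩
  intro S
  induction S using WellFoundedLT.induction with
  | ind S ih =>
    rintro V rfl hV hinv
    by_cases hirr : IsIrreducibleOn T V
    · exact ⟨Unit, inferInstance, fun _ => V, fun _ => hV, fun i j hij => (hij rfl).elim,
        fun _ => hinv, fun _ => hirr, by simp⟩
    simp only [IsIrreducibleOn, not_forall, not_or] at hirr
    obtain ⟨W, hW, hle, hinvW, hW0, hWV⟩ := hirr
    obtain ⟨h1, h2⟩ := (mem_corner_iff hV).1 (hle (mem_corner_self hW))
    have hVW : IsStarProjection (V - W) := hW.sub_of_mul_eq_left hV h2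
    have hmem : V - W ∈ corner V := sub_mem (mem_corner_self hV) (hle (mem_corner_self hW))
    have hle' : corner (V - W) ≤ corner V := corner_le_corner hV hmem
    have hinv' := leavesInvariant_corner_sub hT hsa hV hW hVW hmem hinv hinvW
    have hlt : corner W < corner V := by
      refine lt_of_le_of_ne hle fun h => hWV ?_
      have := ((mem_corner_iff hW).1 (h ▸ mem_corner_self hV)).1
      rw [← h2, this]
    have hlt' : corner (V - W) < corner V := by
      refine lt_of_le_of_ne hle' fun h => hW0 ?_
      have := ((mem_corner_iff hVW).1 (h ▸ mem_corner_self hV)).1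
      rw [sub_mul, hV.1.eq, h2] at this
      exact sub_eq_self.mp this
    obtain ⟨ι, _, A, a1, a2, a3, a4, a5⟩ := ih _ hlt W rfl hW hinvW
    obtain ⟨κ, _, B, b1, b2, b3, b4, b5⟩ := ih _ hlt' (V - W) rfl hVW hinv'
    classical
    have hA : ∀ i, A i * W = A i := fun i => by
      rw [← a5, Finset.mul_sum, Finset.sum_eq_single i (fun j _ hj => a2 i j hj.symm) (by simp),
        (a1 i).1.eq]
    have hB : ∀ i, (V - W) * B i = B i := fun i => by
      rw [← b5, Finset.sum_mul, Finset.sum_eq_single i (fun j _ hj => b2 j i hj) (by simp),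
        (b1 i).1.eq]
    have hAB : ∀ i j, A i * B j = 0 := fun i j => by
      rw [← hA, ← hB, mul_assoc, ← mul_assoc W, mul_sub, h2, hW.1.eq, sub_self, zero_mul,
        mul_zero]
    refine ⟨ι ⊕ κ, inferInstance, Sum.elim A B, ?_, ?_, ?_, ?_, ?_⟩
    · rintro (i | i)
      exacts [a1 i, b1 i]
    · rintro (i | i) (j | j) hij
      · exact a2 i j fun h => hij (h ▸ rfl)
      · exact hAB i j
      · exact mul_eq_zero_comm_of_isHermitian (a1 j).2 (b1 i).2 (hAB j i)
      · exact b2 i j fun h => hij (h ▸ rfl)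
    · rintro (i | i)
      exacts [a3 i, b3 i]
    · rintro (i | i)
      exacts [a4 i, b4 i]
    · simp [a5, b5]

/-- Let the corners of `P` and `Q` be invariant, that of `P` irreducible. The meet of `P` and `Q`
has an invariant corner, hence is `P` or `0`. In the first case `P` lies below `Q`; in the second
`T (P * Q * P)`, which lies in both corners because it is dominated by `T Q`, vanishes. -/
theorem irreducible_dichotomy (hT : ∀ X, X.PosSemidef → (T X).PosSemidef)
    {P Q : Matrix (Fin k) (Fin k) ℂ} (hP : IsStarProjection P) (hQ : IsStarProjection Q)
    (hinvP : LeavesInvariant T (corner P)) (hirr : IsIrreducibleOn T P)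
    (hinvQ : LeavesInvariant T (corner Q)) (hle : (T Q - T (P * Q * P)).PosSemidef) :
    P * (1 - Q) = 0 ∨ T (P * Q * P) = 0 := by
  obtain ⟨U, hU, hUiff⟩ := exists_meet_projection hP hQ
  obtain ⟨hPU, hQU⟩ := (hUiff U).1 hU.1.eq
  have hmemP : U ∈ corner P := by
    refine (mem_corner_iff hP).2 ⟨hPU, ?_⟩
    have := congrArg conjTranspose hPU
    rwa [conjTranspose_mul, show Uᴴ = U from hU.2, show Pᴴ = P from hP.2] at this
  have hmemQ : U ∈ corner Q := by
    refine (mem_corner_iff hQ).2 ⟨hQU, ?_⟩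
    have := congrArg conjTranspose hQU
    rwa [conjTranspose_mul, show Uᴴ = U from hU.2, show Qᴴ = Q from hQ.2] at this
  have hTU : T U * (1 - U) = 0 := by
    have h : U * T U = T U := (hUiff _).2 ⟨((mem_corner_iff hP).1 (hinvP _ hmemP)).1,
      ((mem_corner_iff hQ).1 (hinvQ _ hmemQ)).1⟩
    refine mul_eq_zero_comm_of_isHermitian (posSemidef_of_isStarProjection hU.one_sub).1
      (hT U (posSemidef_of_isStarProjection hU)).1 ?_
    rw [sub_mul, one_mul, h, sub_self]
  rcases hirr U hU (corner_le_corner hP hmemP) ((leavesInvariant_iff hT hU).2 hTU) with h | h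
  · right
    have hPQP : (P * Q * P).PosSemidef := by
      have := (posSemidef_of_isStarProjection hQ).conjTranspose_mul_mul_same P
      rwa [show Pᴴ = P from hP.2] at this
    have hA := hT _ hPQP
    have h1 : P * T (P * Q * P) = T (P * Q * P) := ((mem_corner_iff hP).1 (hinvP _ ⟨Q, rfl⟩)).1
    have h2 : T (P * Q * P) * (1 - Q) = 0 := by
      refine mul_eq_zero_of_add_mul_eq_zero hA hle ?_
      rw [add_sub_cancel]
      exact (leavesInvariant_iff hT hQ).1 hinvQ
    have h3 := mul_eq_zero_comm_of_isHermitian hA.1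
      (posSemidef_of_isStarProjection hQ.one_sub).1 h2
    rw [sub_mul, one_mul, sub_eq_zero] at h3
    rw [← (hUiff _).2 ⟨h1, h3.symm⟩, h, zero_mul]
  · left
    rw [mul_sub, mul_one, sub_eq_zero, ← h, ((mem_corner_iff hQ).1 hmemQ).2]

end Corner

/-! ### The maps attached to a state and the decomposition property -/

section State

variable {k m : ℕ} {γ δ : Matrix (Fin k × Fin m) (Fin k × Fin m) ℂ}

theorem mapG_apply (γ : Matrix (Fin k × Fin m) (Fin k × Fin m) ℂ) (X : Matrix (Fin k) (Fin k) ℂ)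
    (b d : Fin m) : mapG γ X b d = ∑ a, ∑ c, γ (a, b) (c, d) * X c a := rfl

theorem mapF_apply (γ : Matrix (Fin k × Fin m) (Fin k × Fin m) ℂ) (Y : Matrix (Fin m) (Fin m) ℂ)
    (a c : Fin k) : mapF γ Y a c = ∑ b, ∑ d, γ (a, b) (c, d) * Y d b := rfl

theorem mapF_eq_mapG_submatrix (γ : Matrix (Fin k × Fin m) (Fin k × Fin m) ℂ) :
    mapF γ = mapG (γ.submatrix Prod.swap Prod.swap) := rfl

theorem mapG_add : mapG (γ + δ) = mapG γ + mapG δ := by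
  ext X b d
  simp only [LinearMap.add_apply, Matrix.add_apply, mapG_apply, add_mul, Finset.sum_add_distrib]

theorem mapF_add : mapF (γ + δ) = mapF γ + mapF δ := by
  simp only [mapF_eq_mapG_submatrix, submatrix_add, Pi.add_apply, mapG_add]

theorem mapG_smul (c : ℝ) : mapG (c • γ) = c • mapG γ := by
  ext X b d
  simp only [LinearMap.smul_apply, Matrix.smul_apply, mapG_apply, smul_mul_assoc, Finset.smul_sum]

theorem mapF_smul (c : ℝ) : mapF (c • γ) = c • mapF γ := by
  simp only [mapF_eq_mapG_submatrix, submatrix_smul, Pi.smul_apply, mapG_smul]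

/-- If `X = Cᴴ * C`, then `mapG γ X` is the sum of the compressions of `γ` along the rows
of `C`. -/
theorem mapG_posSemidef (hγ : γ.PosSemidef) {X : Matrix (Fin k) (Fin k) ℂ} (hX : X.PosSemidef) :
    (mapG γ X).PosSemidef := by
  obtain ⟨C, rfl⟩ : ∃ C : Matrix (Fin k) (Fin k) ℂ, X = Cᴴ * C := by
    open scoped MatrixOrder Matrix.Norms.L2Operator in
    exact CStarAlgebra.nonneg_iff_eq_star_mul_self.mp hX.nonneg
  let K : Fin k → Matrix (Fin k × Fin m) (Fin m) ℂ := fun e =>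
    Matrix.of fun p d => if p.2 = d then star (C e p.1) else 0
  have h : mapG γ (Cᴴ * C) = ∑ e, (K e)ᴴ * γ * K e := by
    ext b d
    have hterm : ∀ e, ((K e)ᴴ * γ * K e) b d =
        ∑ a, ∑ c, γ (a, b) (c, d) * (star (C e c) * C e a) := fun e => by
      simp only [K, mul_apply, conjTranspose_apply, of_apply, Fintype.sum_prod_type, apply_ite star,
        star_star, star_zero, ite_mul, mul_ite, zero_mul, mul_zero, Finset.sum_ite_eq',
        Finset.mem_univ, if_true, Finset.sum_mul]
      rw [Finset.sum_comm]
      refine Finset.sum_congr rfl fun a _ => Finset.sum_congr rfl fun c _ => ?_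
      ring
    simp only [Matrix.sum_apply, hterm, mapG_apply, mul_apply, conjTranspose_apply,
      Finset.mul_sum]
    exact Finset.sum_comm_cycle
  rw [h]
  exact posSemidef_sum _ fun e _ => hγ.conjTranspose_mul_mul_same _

theorem mapF_posSemidef (hγ : γ.PosSemidef) {Y : Matrix (Fin m) (Fin m) ℂ} (hY : Y.PosSemidef) :
    (mapF γ Y).PosSemidef := by
  rw [mapF_eq_mapG_submatrix]
  exact mapG_posSemidef (hγ.submatrix _) hY

theorem mapG_conjTranspose (hγ : γ.IsHermitian) (X : Matrix (Fin k) (Fin k) ℂ) :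
    mapG γ Xᴴ = (mapG γ X)ᴴ := by
  ext b d
  simp only [mapG_apply, conjTranspose_apply, star_sum, star_mul']
  rw [Finset.sum_comm]
  refine Finset.sum_congr rfl fun a _ => Finset.sum_congr rfl fun c _ => ?_
  rw [hγ.apply]

theorem mapF_conjTranspose (hγ : γ.IsHermitian) (Y : Matrix (Fin m) (Fin m) ℂ) :
    mapF γ Yᴴ = (mapF γ Y)ᴴ := by
  rw [mapF_eq_mapG_submatrix]
  exact mapG_conjTranspose (hγ.submatrix _) Y

/-- Both sides are `tr (γ * (X ⊗ Y))`. -/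
theorem trace_mapF_mul (γ : Matrix (Fin k × Fin m) (Fin k × Fin m) ℂ)
    (X : Matrix (Fin k) (Fin k) ℂ) (Y : Matrix (Fin m) (Fin m) ℂ) :
    (mapF γ Y * X).trace = (Y * mapG γ X).trace := by
  simp only [trace, diag_apply, mul_apply, mapF_apply, mapG_apply, Finset.sum_mul, Finset.mul_sum]
  have e1 : ∀ f : Fin k → Fin k → Fin m → Fin m → ℂ,
      ∑ a, ∑ c, ∑ b, ∑ d, f a c b d = ∑ d, ∑ b, ∑ a, ∑ c, f a c b d := fun f => by
    rw [Finset.sum_congr rfl fun a _ => Finset.sum_comm_cycle, Finset.sum_comm]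
    exact Finset.sum_congr rfl fun d _ => Finset.sum_comm_cycle
  rw [e1]
  refine Finset.sum_congr rfl fun d _ => Finset.sum_congr rfl fun b _ =>
    Finset.sum_congr rfl fun a _ => Finset.sum_congr rfl fun c _ => ?_
  ring

/-- The endomorphism `F_γ ∘ G_γ` of `M_k`. -/
abbrev mapFG (γ : Matrix (Fin k × Fin m) (Fin k × Fin m) ℂ) :
    Matrix (Fin k) (Fin k) ℂ →ₗ[ℂ] Matrix (Fin k) (Fin k) ℂ :=
  mapF γ ∘ₗ mapG γ

theorem mapFG_posSemidef (hγ : γ.PosSemidef) (X : Matrix (Fin k) (Fin k) ℂ) (hX : X.PosSemidef) :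
    (mapFG γ X).PosSemidef :=
  mapF_posSemidef hγ (mapG_posSemidef hγ hX)

theorem trace_mapFG_mul (X Y : Matrix (Fin k) (Fin k) ℂ) :
    (mapFG γ X * Y).trace = (X * mapFG γ Y).trace := by
  simp only [mapFG, LinearMap.comp_apply]
  rw [trace_mapF_mul, trace_mul_comm X, trace_mapF_mul, trace_mul_comm]

/-- `F_γ` is the adjoint of `G_γ`, so `F_γ ∘ G_γ` has the same kernel as `G_γ`. -/
theorem mapFG_eq_zero_iff (hγ : γ.PosSemidef) (X : Matrix (Fin k) (Fin k) ℂ) :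
    mapFG γ X = 0 ↔ mapG γ X = 0 := by
  constructor
  · intro h
    have h1 := trace_mapF_mul γ Xᴴ (mapG γ X)
    rw [show mapF γ (mapG γ X) = 0 from h, Matrix.zero_mul, trace_zero,
      mapG_conjTranspose hγ.1] at h1
    exact trace_mul_conjTranspose_self_eq_zero_iff.1 h1.symm
  · intro h
    simp only [mapFG, LinearMap.comp_apply, h, map_zero]

/-- The decomposition property of a state `γ`: whenever the corner of a projection `W` is
invariant under `F_γ ∘ G_γ`, the off-diagonal part `W * X * (1 - W)` is killed by `G_γ`. -/
def HasDecompositionProperty (γ : Matrix (Fin k × Fin m) (Fin k × Fin m) ℂ) : Prop :=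
  ∀ W : Matrix (Fin k) (Fin k) ℂ, IsStarProjection W → mapFG γ W * (1 - W) = 0 →
    ∀ X, mapG γ (W * X * (1 - W)) = 0

/-- Split `1` into orthogonal projections with invariant irreducible corners. A matrix orthogonal to
all these corners is a sum of off-diagonal parts, each killed by the decomposition property. -/
theorem mem_CR_of_decompositionProperty (hγ : γ.PosSemidef) (h : HasDecompositionProperty γ) :
    γ ∈ CR k m := by
  have hpos := mapFG_posSemidef hγ
  refine ⟨hγ, fun _ _ => mem_corner_one, fun X _ => hpos X, fun X _ Y _ => ?_, ?_⟩
  · have h1 : mapFG γ Yᴴ = (mapFG γ Y)ᴴ := by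
      simp only [mapFG, LinearMap.comp_apply]
      rw [mapG_conjTranspose hγ.1, mapF_conjTranspose hγ.1]
    change (mapFG γ X * Yᴴ).trace = (X * (mapFG γ Y)ᴴ).trace
    rw [trace_mapFG_mul, h1]
  obtain ⟨l, W, h1, h2, h3, h4, h5⟩ := exists_irreducible_decomposition hpos trace_mapFG_mul 1
    (IsStarProjection.one _) fun _ _ => mem_corner_one
  refine ⟨l, W, h1, fun i X _ => mem_corner_one, h2, h3, h4, fun X _ hX => ?_⟩
  have hdiag : ∀ i, W i * X * W i = 0 := fun i => by
    have h0 := hX i (W i * X * W i) ⟨X, rfl⟩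
    have hWs : (W i)ᴴ = W i := (h1 i).2
    apply trace_mul_conjTranspose_self_eq_zero_iff.1
    rw [← h0]
    have hWW : ∀ Y, W i * (W i * Y) = W i * Y := fun Y => by rw [← mul_assoc, (h1 i).1.eq]
    simp only [conjTranspose_mul, hWs, mul_assoc, hWW]
    rw [trace_mul_comm]
    simp only [mul_assoc, (h1 i).1.eq]
  have hX' : X = ∑ i, W i * X * (1 - W i) := by
    simp only [mul_sub, mul_one, hdiag, sub_zero]
    rw [← Finset.sum_mul, h5, one_mul]
  change mapFG γ X = 0
  rw [hX', map_sum]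
  exact Finset.sum_eq_zero fun i _ => (mapFG_eq_zero_iff hγ _).2
    (h (W i) (h1 i) ((leavesInvariant_iff hpos (h1 i)).1 (h3 i)) X)

/-- If `T = F_γ ∘ G_γ` is completely reducible with projections `P i`, then
`T X = ∑ i, T (P i * X * P i)`. Given an invariant corner of `W`, each `P i` lies below `W`, below
`1 - W`, or satisfies `T (P i) = 0`, and in all three cases the `i`-th term vanishes on
`W * X * (1 - W)`. -/
theorem decompositionProperty_of_mem_CR (h : γ ∈ CR k m) : HasDecompositionProperty γ := by
  obtain ⟨hγ, -, -, -, l, P, h1, -, h2, h3, h4, h5⟩ := h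
  have hpos := mapFG_posSemidef hγ
  intro W hW hinv X
  -- `X - ∑ j, P j * X * P j` is orthogonal to every corner, so the map kills it.
  have hsum : ∀ X, mapFG γ X = ∑ i, mapFG γ (P i * X * P i) := fun X => by
    rw [← map_sum, ← sub_eq_zero, ← map_sub]
    refine h5 _ mem_corner_one ?_
    rintro i _ ⟨Y, rfl⟩
    have hPs : (P i)ᴴ = P i := (h1 i).2
    have hcomp : P i * (X - ∑ j, P j * X * P j) * P i = 0 := by
      rw [mul_sub, sub_mul, Finset.mul_sum, Finset.sum_mul, Finset.sum_eq_single i, sub_eq_zero]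
      · simp only [mul_assoc, (h1 i).1.eq]
        rw [← mul_assoc (P i) (P i), (h1 i).1.eq]
      · intro j _ hj
        rw [← mul_assoc, ← mul_assoc, h2 i j hj.symm, zero_mul, zero_mul, zero_mul]
      · simp
    have hcyc : (X - ∑ j, P j * X * P j) * (P i * Y * P i)ᴴ =
        ((X - ∑ j, P j * X * P j) * P i) * (Yᴴ * P i) := by
      simp only [conjTranspose_mul, hPs, mul_assoc]
    rw [hcyc, trace_mul_comm, mul_assoc, ← mul_assoc (P i), hcomp, mul_zero, trace_zero]
  have hle : ∀ Q, IsStarProjection Q → ∀ i, (mapFG γ Q - mapFG γ (P i * Q * P i)).PosSemidef := by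
    intro Q hQ i
    rw [hsum Q, ← Finset.add_sum_erase _ _ (Finset.mem_univ i), add_sub_cancel_left]
    refine posSemidef_sum _ fun j _ => hpos _ ?_
    have := (posSemidef_of_isStarProjection hQ).conjTranspose_mul_mul_same (P j)
    rwa [show (P j)ᴴ = P j from (h1 j).2] at this
  have hinvW := (leavesInvariant_iff hpos hW).2 hinv
  have hinvW' : LeavesInvariant (mapFG γ) (corner (1 - W)) := by
    rw [leavesInvariant_iff hpos hW.one_sub, sub_sub_cancel]
    exact map_one_sub_mul_eq_zero hpos trace_mapFG_mul hW hinv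
  rw [← mapFG_eq_zero_iff hγ, hsum]
  refine Finset.sum_eq_zero fun i _ => ?_
  rcases irreducible_dichotomy hpos (h1 i) hW (h3 i) (h4 i) hinvW (hle W hW i) with hc | hc
  · rw [mul_assoc, mul_assoc, mul_eq_zero_comm_of_isHermitian (h1 i).2 hW.one_sub.2 hc,
      mul_zero, mul_zero, map_zero]
  rcases irreducible_dichotomy hpos (h1 i) hW.one_sub (h3 i) (h4 i) hinvW'
    (hle _ hW.one_sub i) with hd | hd
  · rw [sub_sub_cancel] at hd
    rw [← mul_assoc, ← mul_assoc, hd, zero_mul, zero_mul, zero_mul, map_zero]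
  · refine map_corner_eq_zero hpos (h1 i) ?_ ⟨W * X * (1 - W), rfl⟩
    have hsplit : P i = P i * W * P i + P i * (1 - W) * P i := by
      rw [← add_mul, ← mul_add, add_sub_cancel, mul_one, (h1 i).1.eq]
    rw [hsplit, map_add, hc, hd, add_zero]

theorem mem_CR_iff : γ ∈ CR k m ↔ γ.PosSemidef ∧ HasDecompositionProperty γ :=
  ⟨fun h => ⟨h.1, decompositionProperty_of_mem_CR h⟩,
    fun h => mem_CR_of_decompositionProperty h.1 h.2⟩

theorem mapFG_add_apply (X : Matrix (Fin k) (Fin k) ℂ) :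
    mapFG (γ + δ) X =
      mapFG γ X + (mapFG δ X + (mapF γ (mapG δ X) + mapF δ (mapG γ X))) := by
  simp only [mapFG, LinearMap.comp_apply, mapG_add, mapF_add, LinearMap.add_apply, map_add]
  abel

/-- A corner invariant under the map of `γ + δ` is invariant under those of `γ` and `δ`, because
the mixed terms are positive as well. -/
theorem mapFG_mul_eq_zero_of_add (hγ : γ.PosSemidef) (hδ : δ.PosSemidef)
    {X N : Matrix (Fin k) (Fin k) ℂ} (hX : X.PosSemidef) (h : mapFG (γ + δ) X * N = 0) :
    mapFG γ X * N = 0 := by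
  rw [mapFG_add_apply] at h
  exact mul_eq_zero_of_add_mul_eq_zero (mapFG_posSemidef hγ X hX)
    ((mapFG_posSemidef hδ X hX).add ((mapF_posSemidef hγ (mapG_posSemidef hδ hX)).add
      (mapF_posSemidef hδ (mapG_posSemidef hγ hX)))) h

/-! ### The cone of completely reducible states -/

theorem add_mem_CR (hγ : γ ∈ CR k m) (hδ : δ ∈ CR k m) : γ + δ ∈ CR k m := by
  rw [mem_CR_iff] at *
  refine ⟨hγ.1.add hδ.1, fun W hW h X => ?_⟩
  have hWp := posSemidef_of_isStarProjection hW
  rw [mapG_add, LinearMap.add_apply, hγ.2 W hW (mapFG_mul_eq_zero_of_add hγ.1 hδ.1 hWp h),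
    hδ.2 W hW (mapFG_mul_eq_zero_of_add hδ.1 hγ.1 hWp (by rwa [add_comm])), add_zero]

theorem smul_mem_CR (hγ : γ ∈ CR k m) {c : ℝ} (hc : 0 ≤ c) : c • γ ∈ CR k m := by
  rw [mem_CR_iff] at *
  refine ⟨hγ.1.smul hc, fun W hW h X => ?_⟩
  rw [mapG_smul, LinearMap.smul_apply]
  rcases eq_or_ne c 0 with rfl | hc0
  · exact zero_smul _ _
  rw [hγ.2 W hW ?_, smul_zero]
  have h1 : mapFG (c • γ) W = (c * c) • mapFG γ W := by
    simp only [mapFG, LinearMap.comp_apply, mapG_smul, mapF_smul, LinearMap.smul_apply]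
    rw [LinearMap.map_smul_of_tower, smul_smul]
  rw [h1, Matrix.smul_mul] at h
  exact (smul_eq_zero.mp h).resolve_left (mul_ne_zero hc0 hc0)

theorem zero_mem_CR : (0 : Matrix (Fin k × Fin m) (Fin k × Fin m) ℂ) ∈ CR k m := by
  refine mem_CR_iff.2 ⟨.zero, fun W _ _ X => ?_⟩
  ext b d
  simp [mapG_apply]

theorem mapG_one_apply (X : Matrix (Fin k) (Fin k) ℂ) :
    mapG (1 : Matrix (Fin k × Fin m) (Fin k × Fin m) ℂ) X = X.trace • 1 := by
  have h := mapG_sum_kronecker (n := 1) (fun _ => (1 : Matrix (Fin k) (Fin k) ℂ))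
    (fun _ => (1 : Matrix (Fin m) (Fin m) ℂ)) X
  simpa using h

theorem mapF_one_apply (Y : Matrix (Fin m) (Fin m) ℂ) :
    mapF (1 : Matrix (Fin k × Fin m) (Fin k × Fin m) ℂ) Y = Y.trace • 1 := by
  have h := mapF_sum_kronecker (n := 1) (fun _ => (1 : Matrix (Fin k) (Fin k) ℂ))
    (fun _ => (1 : Matrix (Fin m) (Fin m) ℂ)) Y
  simpa using h

/-- Adding a positive multiple of the identity leaves no invariant corner other than those of
`0` and `1`. -/
theorem add_smul_one_mem_CR (hγ : γ.PosSemidef) {ε : ℝ} (hε : 0 < ε) : γ + ε • 1 ∈ CR k m := by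
  have hone : (ε • (1 : Matrix (Fin k × Fin m) (Fin k × Fin m) ℂ)).PosSemidef :=
    PosSemidef.one.smul hε.le
  refine mem_CR_iff.2 ⟨hγ.add hone, fun W hW h X => ?_⟩
  -- For `m = 0` the target of `mapG` is trivial.
  rcases Nat.eq_zero_or_pos m with rfl | hm
  · exact Subsingleton.elim _ _
  have hWp := posSemidef_of_isStarProjection hW
  have h1 : mapFG (ε • (1 : Matrix (Fin k × Fin m) (Fin k × Fin m) ℂ)) W * (1 - W) = 0 :=
    mapFG_mul_eq_zero_of_add hone hγ hWp (by rwa [add_comm])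
  simp only [mapFG, LinearMap.comp_apply, mapG_smul, mapF_smul, LinearMap.smul_apply,
    mapG_one_apply, LinearMap.map_smul_of_tower, map_smul, mapF_one_apply, Matrix.smul_mul,
    trace_one, Fintype.card_fin, one_mul, smul_eq_zero, hε.ne', Nat.cast_eq_zero, hm.ne',
    false_or] at h1
  rcases h1 with h1 | h1
  · rw [hWp.trace_eq_zero_iff.1 h1, zero_mul, zero_mul, map_zero]
  · rw [h1, mul_zero, map_zero]

theorem states_subset_closure_CR : states k m ⊆ closure (CR k m) := by
  intro γ hγ
  have hlim : Filter.Tendsto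
      (fun ε : ℝ => γ + ε • (1 : Matrix (Fin k × Fin m) (Fin k × Fin m) ℂ))
      (nhdsWithin 0 (Set.Ioi 0)) (nhds γ) := by
    have hcont : Continuous
        (fun ε : ℝ => γ + ε • (1 : Matrix (Fin k × Fin m) (Fin k × Fin m) ℂ)) := by
      fun_prop
    have := hcont.tendsto 0
    rw [zero_smul, add_zero] at this
    exact this.mono_left nhdsWithin_le_nhds
  exact mem_closure_of_tendsto hlim
    (Filter.eventually_of_mem self_mem_nhdsWithin fun ε hε => add_smul_one_mem_CR hγ hε)

theorem mapG_single (γ : Matrix (Fin k × Fin m) (Fin k × Fin m) ℂ) (a c : Fin k) (b d : Fin m) :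
    mapG γ (single c a 1) b d = γ (a, b) (c, d) := by
  rw [mapG_apply, Finset.sum_eq_single a, Finset.sum_eq_single c]
  · simp
  · intro c' _ hc
    simp [hc.symm]
  · simp
  · intro a' _ ha
    simp [ha.symm]
  · simp

theorem mapF_single (γ : Matrix (Fin k × Fin m) (Fin k × Fin m) ℂ) (a c : Fin k) (b d : Fin m) :
    mapF γ (single d b 1) a c = γ (a, b) (c, d) := by
  rw [mapF_eq_mapG_submatrix, mapG_single]
  rfl

/-- The maximally entangled state of a pair of qubits, `v * vᴴ` with `v = e₀ ⊗ e₀ + e₁ ⊗ e₁`, is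
not completely reducible: the corner of `e₀ * e₀ᴴ` is invariant, but the off-diagonal matrix unit
`e₀ * e₁ᴴ` is not annihilated. -/
theorem exists_state_notMem_CR (hk : 2 ≤ k) (hm : 2 ≤ m) : ∃ γ ∈ states k m, γ ∉ CR k m := by
  obtain ⟨a₀, a₁, ha⟩ : ∃ a₀ a₁ : Fin k, a₀ ≠ a₁ :=
    ⟨⟨0, by omega⟩, ⟨1, by omega⟩, by simp⟩
  obtain ⟨b₀, b₁, hb⟩ : ∃ b₀ b₁ : Fin m, b₀ ≠ b₁ :=
    ⟨⟨0, by omega⟩, ⟨1, by omega⟩, by simp⟩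
  let v : Fin k × Fin m → ℂ := fun p => if p = (a₀, b₀) ∨ p = (a₁, b₁) then 1 else 0
  have hγ : (vecMulVec v (star v)).PosSemidef := posSemidef_vecMulVec_self_star v
  have hva : ∀ b, v (a₀, b) = if b = b₀ then 1 else 0 := fun b => by simp [v, ha]
  have hvb : ∀ a, v (a, b₀) = if a = a₀ then 1 else 0 := fun a => by simp [v, hb]
  have hv1 : v (a₁, b₁) = 1 := by simp [v]
  have hG : mapG (vecMulVec v (star v)) (single a₀ a₀ 1) = single b₀ b₀ 1 := by
    ext b d
    rw [mapG_single, vecMulVec_apply, Pi.star_apply, hva, hva, single_apply]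
    simp only [eq_comm (a := b₀)]
    by_cases h1 : b = b₀ <;> by_cases h2 : d = b₀ <;> simp [h1, h2]
  have hF : mapF (vecMulVec v (star v)) (single b₀ b₀ 1) = single a₀ a₀ 1 := by
    ext a c
    rw [mapF_single, vecMulVec_apply, Pi.star_apply, hvb, hvb, single_apply]
    simp only [eq_comm (a := a₀)]
    by_cases h1 : a = a₀ <;> by_cases h2 : c = a₀ <;> simp [h1, h2]
  refine ⟨_, hγ, fun h => ?_⟩
  have hE : IsStarProjection (single a₀ a₀ (1 : ℂ)) := by
    refine ⟨?_, ?_⟩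
    · change single a₀ a₀ (1 : ℂ) * single a₀ a₀ 1 = _
      simp
    · change (single a₀ a₀ (1 : ℂ))ᴴ = _
      simp
  have hX := decompositionProperty_of_mem_CR h _ hE
    (by rw [mapFG, LinearMap.comp_apply, hG, hF, hE.mul_one_sub_self]) (single a₀ a₁ 1)
  rw [mul_sub, mul_one, single_mul_single_same,
    single_mul_single_of_ne _ _ _ _ ha.symm, sub_zero, mul_one] at hX
  have h1 := mapG_single (vecMulVec v (star v)) a₁ a₀ b₁ b₀
  rw [hX, vecMulVec_apply, Pi.star_apply, hva, hv1] at h1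
  simp at h1

end State

end CompRed

theorem mainTheorem2 (k m : ℕ) :
    (0 ∈ CompRed.CR k m ∧
      (∀ γ ∈ CompRed.CR k m, ∀ c : ℝ, 0 ≤ c → c • γ ∈ CompRed.CR k m) ∧
      Convex ℝ (CompRed.CR k m)) ∧
    CompRed.CR k m ⊆ CompRed.states k m ∧
    CompRed.states k m ⊆ closure (CompRed.CR k m) ∧
    (2 ≤ k → 2 ≤ m → ¬ IsClosed (CompRed.CR k m)) := by
  refine ⟨⟨CompRed.zero_mem_CR, fun γ hγ c hc => CompRed.smul_mem_CR hγ hc,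
    fun γ hγ δ hδ a b ha hb _ =>
      CompRed.add_mem_CR (CompRed.smul_mem_CR hγ ha) (CompRed.smul_mem_CR hδ hb)⟩,
    fun γ hγ => hγ.1, CompRed.states_subset_closure_CR, fun hk hm hcl => ?_⟩
  obtain ⟨γ, hγ, hnot⟩ := CompRed.exists_state_notMem_CR hk hm
  exact hnot (hcl.closure_eq ▸ CompRed.states_subset_closure_CR hγ)
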